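/- **Conventions.** Let $R$ be a (commutative) integral domain, $R^*=R\setminus\{0\}$. $R$ is a *large ideal domain* (LID) if it is infinite and countable and for every $x\in R^*$ the ideal $xR$ has finite index as an additive subgroup of $R$. The affine semigroup $\mathcal A_R$ consists of all maps $x\mapsto ux+v$ of $R$ with $u\in R^*$, $v\in R$, under composition; write $A_v(x)=x+v$ $(v\in R)$ and $M_u(x)=ux$ $(u\in R^*)$. A set $S\subset R$ is *affinely syndetic* if there is a finite $F\subset\mathcal A_R$ such that for every $x\in R$ some $g\in F$ satisfies $g(x)\in S$. Let $\beta R$ be the space of ultrafilters on $R$, with the topology generated by the sets $\{p:E\in p\}$, $E\subset R$, and identify $\beta(R^*)$ with $\beta R$ minus the principal ultrafilter at $0$. For $p,q\in\beta R$, let $E\in p+q$ iff $\{u:\{x:u+x\in E\}\in q\}\in p$, and $E\in pq$ iff $\{u:\{x:ux\in E\}\in q\}\in p$. Each $A_v$ acts on $\beta R$, and each $M_u$ ($u\in R^*$) on $\beta(R^*)$, by push-forward of ultrafilters. Let $\mathcal{AMI}$ be the set of non-principal $p\in\beta R$ with $p+p=p$ that lie in a minimal non-empty compact subset of $\beta R$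 invariant under all $A_v$, $v\in R$; let $\mathcal{MMI}$ be the set of non-principal $p\in\beta(R^*)$ with $pp=p$ that lie in a minimal non-empty compact subset of $\beta(R^*)$ invariant under all $M_u$, $u\in R^*$. Put $\mathcal G=\overline{\mathcal{AMI}}\cap\mathcal{MMI}$. A set $C\subset R$ is $DC$ if it belongs to some $p\in\mathcal G$, and $DC^*$ if it has non-empty intersection with every $DC$ set. A measure preserving action of $\mathcal A_R$ on a probability space $(\Omega,\mu)$ is a family $(T_g)_{g\in\mathcal A_R}$ of measurable maps $T_g:\Omega\to\Omega$ that preserve $\mu$ and satisfy $T_{gh}=T_g\circ T_h$ for all $g,h\in\mathcal A_R$. **Theorem.** Let $R$ be an LID, let $(T_g)_{g\in\mathcal A_R}$ be a measure preserving action of $\mathcal A_R$ on a probability space $(\Omega,\mu)$, let $B\subset\Omega$ be measurable and let $\varepsilon>0$. Then the set $$\{u\in R^*:\ \mu\big(T_{A_u}^{-1}B\cap T_{M_u}^{-1}B\big)\ge\mu(B)^2-\varepsilon\}$$ is $DC^*$; equivalently, it belongs to every $p\in\mathcal G$. In particular, it is affinely syndetic. -/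

import Mathlib

open MeasureTheory

/-- A large ideal domain (LID): an infinite countable integral domain in which every ideal `xR`
with `x ≠ 0` has finite index as an additive subgroup. -/
structure IsLID (R : Type*) [CommRing R] [IsDomain R] : Prop where
  infinite : Infinite R
  countable : Countable R
  finiteIndex : ∀ x : R, x ≠ 0 → (Submodule.toAddSubgroup (Ideal.span {x})).FiniteIndex

/-- The affine semigroup of `R`: all maps `x ↦ u * x + v` with `u ≠ 0`, under composition
(multiplication in `Function.End R` is composition of functions). -/
def affineSemigroup (R : Type*) [CommRing R] [IsDomain R] : Submonoid (Function.End R) where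
  carrier := {f | ∃ u v : R, u ≠ 0 ∧ ∀ x, f x = u * x + v}
  one_mem' := ⟨1, 0, one_ne_zero, fun x => by
    rw [one_mul, add_zero]
    rfl⟩
  mul_mem' := by
    rintro f g ⟨u, v, hu, hf⟩ ⟨u', v', hu', hg⟩
    refine ⟨u * u', u * v' + v, mul_ne_zero hu hu', fun x => ?_⟩
    change f (g x) = _
    rw [hg, hf]
    ring

/-- The translation `A_v : x ↦ x + v`, as an element of the affine semigroup. -/
def affAdd {R : Type*} [CommRing R] [IsDomain R] (v : R) : affineSemigroup R :=
  ⟨fun x => x + v, 1, v, one_ne_zero, fun x => by rw [one_mul]⟩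

/-- The dilation `M_u : x ↦ u * x` with `u ≠ 0`, as an element of the affine semigroup. -/
def affMul {R : Type*} [CommRing R] [IsDomain R] (u : R) (hu : u ≠ 0) : affineSemigroup R :=
  ⟨fun x => u * x, u, 0, hu, fun x => by rw [add_zero]⟩

/-- A family `(T_g)` of self-maps of `Ω` indexed by a semigroup `G` is a measure preserving action:
every `T_g` is (measurable and) measure preserving, and `T_{gh} = T_g ∘ T_h`. -/
structure IsMeasurePreservingAction {G Ω : Type*} [Semigroup G] [MeasurableSpace Ω]
    (μ : Measure Ω) (T : G → Ω → Ω) : Prop where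
  measurePreserving : ∀ g, MeasurePreserving (T g) μ μ
  map_mul : ∀ g h, T (g * h) = T g ∘ T h

/-- `S ⊆ R` is affinely syndetic: finitely many preimages of `S` under affine maps cover `R`. -/
def IsAffinelySyndetic {R : Type*} [CommRing R] [IsDomain R] (S : Set R) : Prop :=
  ∃ F : Set (affineSemigroup R), F.Finite ∧ ⋃ g ∈ F, {x : R | (g : Function.End R) x ∈ S} = Set.univ

/-- An ultrafilter is non-principal. -/
def NonPrincipal {X : Type*} (p : Ultrafilter X) : Prop :=
  ∀ x : X, p ≠ pure x

/-- Non-empty compact subsets of `βR` invariant under all translations `A_v`. -/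
def IsAddSubsystem {R : Type*} [CommRing R] (Y : Set (Ultrafilter R)) : Prop :=
  Y.Nonempty ∧ IsCompact Y ∧ ∀ v : R, ∀ q ∈ Y, q.map (fun x => x + v) ∈ Y

/-- Non-empty compact subsets of `β(R \ {0}) = βR \ {0}` (ultrafilters on `R` other than the
principal one at `0`) invariant under all dilations `M_u`, `u ≠ 0`. -/
def IsMulSubsystem {R : Type*} [CommRing R] (Y : Set (Ultrafilter R)) : Prop :=
  Y.Nonempty ∧ IsCompact Y ∧ (∀ q ∈ Y, q ≠ pure 0) ∧
    ∀ u : R, u ≠ 0 → ∀ q ∈ Y, q.map (fun x => u * x) ∈ Y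

/-- The sum of ultrafilters: `E ∈ p + q` iff `{u | {x | u + x ∈ E} ∈ q} ∈ p`. -/
def ultraAdd {R : Type*} [CommRing R] (p q : Ultrafilter R) : Ultrafilter R :=
  Ultrafilter.add.add p q

/-- The product of ultrafilters: `E ∈ p q` iff `{u | {x | u * x ∈ E} ∈ q} ∈ p`. -/
def ultraMul {R : Type*} [CommRing R] (p q : Ultrafilter R) : Ultrafilter R :=
  Ultrafilter.mul.mul p q

theorem mem_ultraAdd {R : Type*} [CommRing R] (p q : Ultrafilter R) (E : Set R) :
    E ∈ ultraAdd p q ↔ {u : R | {x : R | u + x ∈ E} ∈ q} ∈ p :=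
  Iff.rfl

theorem mem_ultraMul {R : Type*} [CommRing R] (p q : Ultrafilter R) (E : Set R) :
    E ∈ ultraMul p q ↔ {u : R | {x : R | u * x ∈ E} ∈ q} ∈ p :=
  Iff.rfl

/-- The additive minimal idempotents of `βR`. -/
def AMI (R : Type*) [CommRing R] : Set (Ultrafilter R) :=
  {p | NonPrincipal p ∧ (∃ Y, Minimal IsAddSubsystem Y ∧ p ∈ Y) ∧ ultraAdd p p = p}

/-- The multiplicative minimal idempotents of `β(R \ {0})`. -/
def MMI (R : Type*) [CommRing R] : Set (Ultrafilter R) :=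
  {p | NonPrincipal p ∧ (∃ Y, Minimal IsMulSubsystem Y ∧ p ∈ Y) ∧ ultraMul p p = p}

/-- The class of ultrafilters in the closure of `AMI` that belong to `MMI`. -/
def ultraG (R : Type*) [CommRing R] : Set (Ultrafilter R) :=
  closure (AMI R) ∩ MMI R

/-- `DC` (double central) sets. -/
def IsDC {R : Type*} [CommRing R] (C : Set R) : Prop :=
  ∃ p ∈ ultraG R, C ∈ p

/-- `DC*` sets. -/
def IsDCStar {R : Type*} [CommRing R] (C : Set R) : Prop :=
  ∀ D : Set R, IsDC D → (C ∩ D).Nonempty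

/-- The set of `u ≠ 0` such that `μ (A_u⁻¹ B ∩ M_u⁻¹ B) ≥ μ (B) ^ 2 - ε`
(`M_u` is an element of the affine semigroup only for `u ≠ 0`). -/
def returnSet {R Ω : Type*} [CommRing R] [IsDomain R] [MeasurableSpace Ω] (μ : Measure Ω)
    (T : affineSemigroup R → Ω → Ω) (B : Set Ω) (ε : ℝ) : Set R :=
  {u | ∃ hu : u ≠ 0,
    μ.real (T (affAdd u) ⁻¹' B ∩ T (affMul u hu) ⁻¹' B) ≥ μ.real B ^ 2 - ε}

/-!
The composition operators `A v f = f ∘ T (A_v)` and `M u f = f ∘ T (M_u)` on the real Hilbert space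
`L²(μ)` are isometries, the `A v` are invertible, and `A v * M u = M u * A (u * v)`; taking adjoints,
`(M u)† * A v = A (u * v) * (M u)†`. For `f = 1_B` the measure in question is `⟪A u f, M u f⟫`, and
the limit of this quantity along `p ∈ ultraG R` is shown to be at least `⟪f, 1⟫ ^ 2 = μ(B) ^ 2`.

Split `L²(μ)` into the almost periodic vectors `K` (those with relatively compact orbit under the
`A v`) and `Kᗮ`. Because ideals `uR` have finite index, both parts are invariant under every `M u`.

* If `f ∈ K`, then `A u f → f` along additive idempotents
  (`IsAffineFamily.tendsto_of_mem_almostPeriodic`).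
* If `f ∈ Kᗮ` and `c ≠ 0`, then `A (c * u) f → 0` weakly along additive minimal idempotents
  (`IsAffineFamily.tendsto_inner_zero_of_mem_AMI`): the weak limit is recurrent, and syndetically
  so by minimality, hence almost periodic.

Both assertions pass to the closure of `AMI R`. If moreover `p` is a multiplicative idempotent and
`f ∈ Kᗮ`, the identity `⟪A (b * u) f, M (b * u) g⟫ = ⟪A (b ^ 2 * u) ((M b)† f), M u g⟫` and an
averaging over finitely many `b` with distinct squares show `⟪A u f, M u g⟫ → 0`
(`IsAffineFamily.tendsto_correlation_zero`). So only the component `k` of `f` in `K` matters, and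
for it the limit is that of `⟪k, M u k⟫`, which is `‖y‖ ^ 2` for the weak limit `y` of `M u k`
(`IsAffineFamily.exists_tendsto_inner_mul`); the Cauchy–Schwarz inequality gives
`‖y‖ ^ 2 ≥ ⟪y, 1⟫ ^ 2 = ⟪f, 1⟫ ^ 2`.

Finally, a set that belongs to every `p ∈ ultraG R` is affinely syndetic
(`isAffinelySyndetic_of_forall_mem_ultraG`), since every non-empty compact set of ultrafilters
invariant under the affine semigroup contains a point of `ultraG R`. This rests on the
Ellis–Numakura lemma and on the invariance of `AMI R` under dilations (`map_mul_mem_AMI`).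
-/

open Filter Topology
open scoped Pointwise

/-! ### Compact invariant sets of ultrafilters -/

/-- A non-empty compact set of ultrafilters that is invariant under push-forward by every map of
the family `Φ`. -/
def IsCompactInvariant {X : Type*} (Φ : Set (X → X)) (Y : Set (Ultrafilter X)) : Prop :=
  Y.Nonempty ∧ IsCompact Y ∧ ∀ f ∈ Φ, ∀ q ∈ Y, q.map f ∈ Y

theorem Ultrafilter.continuous_map_self {X : Type*} (f : X → X) :
    Continuous (fun q : Ultrafilter X => q.map f) :=
  ultrafilterBasis_is_basis.continuous_iff.2 <| Set.forall_mem_range.mpr fun s =>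
    ultrafilter_isOpen_basic (f ⁻¹' s)

theorem IsCompactInvariant.exists_minimal {X : Type*} {Φ : Set (X → X)} {Y : Set (Ultrafilter X)}
    (hY : IsCompactInvariant Φ Y) : ∃ N ⊆ Y, Minimal (IsCompactInvariant Φ) N := by
  refine zorn_superset_nonempty {Y | IsCompactInvariant Φ Y} (fun c hc hchain hne => ?_) Y hY
  refine ⟨⋂₀ c, ⟨?_, ?_, ?_⟩, fun s hs => Set.sInter_subset_of_mem hs⟩
  · have := hne.coe_sort
    exact IsCompact.nonempty_sInter_of_directed_nonempty_isCompact_isClosed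
      (IsChain.directedOn hchain.symm) (fun s hs => (hc hs).1) (fun s hs => (hc hs).2.1)
      (fun s hs => (hc hs).2.1.isClosed)
  · obtain ⟨s, hs⟩ := hne
    exact (hc hs).2.1.of_isClosed_subset
      (isClosed_sInter fun t ht => (hc ht).2.1.isClosed) (Set.sInter_subset_of_mem hs)
  · exact fun f hf q hq s hs => (hc hs).2.2 f hf q (hq s hs)

section Ring

variable {R : Type*} [CommRing R]

theorem isAddSubsystem_iff {Y : Set (Ultrafilter R)} :
    IsAddSubsystem Y ↔ IsCompactInvariant (Set.range fun v x : R => x + v) Y := by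
  simp [IsAddSubsystem, IsCompactInvariant]

theorem IsAddSubsystem.exists_minimal {Y : Set (Ultrafilter R)} (hY : IsAddSubsystem Y) :
    ∃ N ⊆ Y, Minimal IsAddSubsystem N := by
  obtain ⟨N, hN, hmin⟩ := (isAddSubsystem_iff.1 hY).exists_minimal
  exact ⟨N, hN, isAddSubsystem_iff.2 hmin.1,
    fun Z hZ hZN => hmin.2 (isAddSubsystem_iff.1 hZ) hZN⟩

theorem IsMulSubsystem.exists_minimal {Y : Set (Ultrafilter R)} (hY : IsMulSubsystem Y) :
    ∃ N ⊆ Y, Minimal IsMulSubsystem N := by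
  have key : ∀ Z ⊆ Y, IsMulSubsystem Z ↔
      IsCompactInvariant {f : R → R | ∃ u : R, u ≠ 0 ∧ f = fun x => u * x} Z := by
    refine fun Z hZ => ⟨fun h => ⟨h.1, h.2.1, ?_⟩, fun h => ⟨h.1, h.2.1, ?_, ?_⟩⟩
    · rintro f ⟨u, hu, rfl⟩ q hq
      exact h.2.2.2 u hu q hq
    · exact fun q hq => hY.2.2.1 q (hZ hq)
    · exact fun u hu q hq => h.2.2 _ ⟨u, hu, rfl⟩ q hq
  obtain ⟨N, hN, hmin⟩ := ((key Y subset_rfl).1 hY).exists_minimal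
  exact ⟨N, hN, (key N hN).2 hmin.1,
    fun Z hZ hZN => hmin.2 ((key Z (hZN.trans hN)).1 hZ) hZN⟩

/-! ### Sums and products of ultrafilters -/

theorem tendsto_ultrafilter_nhds {ι X : Type*} {l : Filter ι} {F : ι → Ultrafilter X}
    {q : Ultrafilter X} (h : ∀ E ∈ q, ∀ᶠ i in l, E ∈ F i) : Tendsto F l (𝓝 q) := by
  refine (ultrafilterBasis_is_basis.nhds_hasBasis.tendsto_right_iff).2 ?_
  rintro _ ⟨⟨E, rfl⟩, hq⟩
  exact h E hq

theorem tendsto_map_add_ultraAdd (p q : Ultrafilter R) :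
    Tendsto (fun v : R => q.map (fun x => x + v)) p (𝓝 (ultraAdd p q)) := by
  refine tendsto_ultrafilter_nhds fun E hE => ?_
  simpa only [add_comm] using! (mem_ultraAdd p q E).1 hE

theorem tendsto_map_mul_ultraMul (p q : Ultrafilter R) :
    Tendsto (fun u : R => q.map (fun x => u * x)) p (𝓝 (ultraMul p q)) :=
  tendsto_ultrafilter_nhds fun E hE => (mem_ultraMul p q E).1 hE

theorem IsAddSubsystem.ultraAdd_mem {Y : Set (Ultrafilter R)} (hY : IsAddSubsystem Y)
    (p : Ultrafilter R) {q : Ultrafilter R} (hq : q ∈ Y) : ultraAdd p q ∈ Y :=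
  hY.2.1.isClosed.mem_of_tendsto (tendsto_map_add_ultraAdd p q)
    (Eventually.of_forall fun v => hY.2.2 v q hq)

theorem Ultrafilter.ne_pure_iff {X : Type*} {p : Ultrafilter X} {a : X} :
    p ≠ pure a ↔ ∀ᶠ x in p, x ≠ a := by
  have h : p = pure a ↔ ({a} : Set X) ∈ p := by
    refine ⟨fun h => by rw [h]; exact Ultrafilter.mem_pure.2 rfl, fun h => ?_⟩
    exact Ultrafilter.coe_injective
      ((Ultrafilter.unique (pure a : Ultrafilter X)
        (le_pure_iff.2 h : (p : Filter X) ≤ pure a)))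
  rw [ne_eq, h, ← Ultrafilter.compl_mem_iff_notMem]
  rfl

theorem IsMulSubsystem.ultraMul_mem {Y : Set (Ultrafilter R)} (hY : IsMulSubsystem Y)
    {p q : Ultrafilter R} (hp : p ≠ pure 0) (hq : q ∈ Y) : ultraMul p q ∈ Y :=
  hY.2.1.isClosed.mem_of_tendsto (tendsto_map_mul_ultraMul p q)
    ((Ultrafilter.ne_pure_iff.1 hp).mono fun u hu => hY.2.2.2 u hu q hq)

/-- A subsystem is a closed left ideal of `(βR, +)`, so the Ellis–Numakura lemma applies. -/
theorem IsAddSubsystem.exists_idempotent {Y : Set (Ultrafilter R)} (hY : IsAddSubsystem Y) :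
    ∃ p ∈ Y, ultraAdd p p = p :=
  letI : AddSemigroup (Ultrafilter R) := Ultrafilter.addSemigroup
  exists_idempotent_in_compact_add_subsemigroup (M := Ultrafilter R)
    Ultrafilter.continuous_add_left Y hY.1 hY.2.1 fun p _ _ hq => hY.ultraAdd_mem p hq

/-- A subsystem is a closed left ideal of `(β(R \ {0}), ·)`, so the Ellis–Numakura lemma applies. -/
theorem IsMulSubsystem.exists_idempotent {Y : Set (Ultrafilter R)} (hY : IsMulSubsystem Y) :
    ∃ p ∈ Y, ultraMul p p = p :=
  letI : Semigroup (Ultrafilter R) := Ultrafilter.semigroup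
  exists_idempotent_in_compact_subsemigroup (M := Ultrafilter R)
    Ultrafilter.continuous_mul_left Y hY.1 hY.2.1
      fun p hp _ hq => hY.ultraMul_mem (hY.2.2.1 p hp) hq

/-! ### Additive minimal idempotents -/

theorem isClosed_nonPrincipal (X : Type*) : IsClosed {p : Ultrafilter X | NonPrincipal p} := by
  have h : {p : Ultrafilter X | NonPrincipal p} = ⋂ x : X, {p | ({x}ᶜ : Set X) ∈ p} := by
    ext p
    simp only [Set.mem_ofPred_eq, Set.mem_iInter]
    exact forall_congr' fun x => Ultrafilter.ne_pure_iff
  rw [h]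
  exact isClosed_iInter fun x => ultrafilter_isClosed_basic _

theorem NonPrincipal.map {X Z : Type*} {p : Ultrafilter X} (hp : NonPrincipal p) {f : X → Z}
    (hf : Function.Injective f) : NonPrincipal (p.map f) := by
  intro z
  rw [Ultrafilter.ne_pure_iff]
  by_cases hz : ∃ x, f x = z
  · obtain ⟨x, rfl⟩ := hz
    exact (Ultrafilter.ne_pure_iff.1 (hp x)).mono fun y hy h => hy (hf h)
  · change ∀ᶠ y in p, f y ≠ z
    exact Eventually.of_forall fun y hy => hz ⟨y, hy⟩

theorem NonPrincipal.infinite_of_mem {X : Type*} {p : Ultrafilter X} (hp : NonPrincipal p)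
    {E : Set X} (hE : E ∈ p) : E.Infinite := by
  intro hfin
  obtain ⟨x, -, hx⟩ := Ultrafilter.eq_pure_of_finite_mem hfin hE
  exact hp x hx

theorem nonPrincipal_of_mem_closure_AMI {p : Ultrafilter R} (hp : p ∈ closure (AMI R)) :
    NonPrincipal p :=
  closure_minimal (fun _ hq => hq.1) (isClosed_nonPrincipal R) hp

/-- The non-principal ultrafilters form a subsystem, so a minimal subsystem that meets them
consists of them. It does meet them, since it is a left ideal of `(βR, +)`. -/
theorem nonPrincipal_of_mem_minimal [Infinite R] {Y : Set (Ultrafilter R)}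
    (hY : Minimal IsAddSubsystem Y) {q : Ultrafilter R} (hq : q ∈ Y) : NonPrincipal q := by
  have hcl := isClosed_nonPrincipal R
  have hall : (Y ∩ {p | NonPrincipal p}).Nonempty → q ∈ Y ∩ {p | NonPrincipal p} := fun hne =>
    hY.2 ⟨hne, hY.1.2.1.inter_right hcl, fun v p hp =>
      ⟨hY.1.2.2 v p hp.1, hp.2.map (add_left_injective v)⟩⟩ Set.inter_subset_left hq
  by_contra hnp
  obtain ⟨a, rfl⟩ : ∃ a, q = pure a := by simpa [NonPrincipal] using hnp
  refine hnp (hall ?_).2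
  have hmem := hY.1.ultraAdd_mem (hyperfilter R) hq
  refine ⟨_, hmem, ?_⟩
  have h : ultraAdd (hyperfilter R) (pure a) = (hyperfilter R).map (fun x => x + a) := rfl
  rw [h]
  refine NonPrincipal.map (fun x hx => ?_) (add_left_injective a)
  have := (Set.finite_singleton x).notMem_hyperfilter
  rw [hx] at this
  exact this (Ultrafilter.mem_pure.2 rfl)

theorem IsAddSubsystem.exists_mem_AMI [Infinite R] {Y : Set (Ultrafilter R)}
    (hY : IsAddSubsystem Y) : ∃ q ∈ Y, q ∈ AMI R := by
  obtain ⟨N, hN, hmin⟩ := hY.exists_minimal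
  obtain ⟨q, hq, hid⟩ := hmin.1.exists_idempotent
  exact ⟨q, hN hq, nonPrincipal_of_mem_minimal hmin hq, ⟨N, hmin, hq⟩, hid⟩

/-- Members of points of minimal subsystems return syndetically often. -/
theorem exists_finite_return_of_mem_minimal {Y : Set (Ultrafilter R)}
    (hY : Minimal IsAddSubsystem Y) {q : Ultrafilter R} (hq : q ∈ Y) {E : Set R} (hE : E ∈ q) :
    ∃ F : Set R, F.Finite ∧ ∀ w, ∃ v ∈ F, ∀ᶠ x in q, x + (w + v) ∈ E := by
  have hopen : ∀ v : R, IsOpen {r : Ultrafilter R | E ∈ r.map (fun x => x + v)} := fun v =>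
    ultrafilter_isOpen_basic _
  have hcov : Y ⊆ ⋃ v : R, {r : Ultrafilter R | E ∈ r.map (fun x => x + v)} := by
    intro r hr
    by_contra hno
    simp only [Set.mem_iUnion, Set.mem_ofPred_eq, not_exists] at hno
    -- otherwise the points of `Y` whose orbit avoids `E` form a subsystem not containing `q`
    have hZ : IsAddSubsystem (Y ∩ {s : Ultrafilter R | ∀ v : R, E ∉ s.map (fun x => x + v)}) := by
      refine ⟨⟨r, hr, hno⟩, hY.1.2.1.inter_right ?_, ?_⟩
      · simp only [Set.ofPred_forall]
        exact isClosed_iInter fun v => (hopen v).isClosed_compl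
      · rintro v s ⟨hs, hs'⟩
        refine ⟨hY.1.2.2 v s hs, fun w hw => hs' (v + w) ?_⟩
        simpa [Ultrafilter.map_map, Function.comp_def, add_assoc] using! hw
    have := (hY.2 hZ Set.inter_subset_left hq).2 0
    simp at this
    exact this hE
  obtain ⟨t, ht⟩ := hY.1.2.1.elim_finite_subcover _ hopen hcov
  refine ⟨t, t.finite_toSet, fun w => ?_⟩
  obtain ⟨v, hv, hmem⟩ := Set.mem_iUnion₂.1 (ht (hY.1.2.2 w q hq))
  refine ⟨v, hv, ?_⟩
  change ∀ᶠ x in q, x + w + v ∈ E at hmem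
  simpa only [add_assoc] using hmem

theorem tendsto_of_mem_closure {X Z : Type*} [TopologicalSpace Z] {S : Set (Ultrafilter X)}
    {φ : X → Z} {z : Z} (h : ∀ q ∈ S, Tendsto φ q (𝓝 z)) {p : Ultrafilter X}
    (hp : p ∈ closure S) : Tendsto φ p (𝓝 z) := fun U hU =>
  closure_minimal (fun q hq => h q hq hU) (ultrafilter_isClosed_basic (φ ⁻¹' U)) hp

/-! ### Dilations of additive minimal idempotents -/

variable [IsDomain R]

/-- Representatives `r` of the finitely many cosets of `uR` in `R`. -/
theorem IsLID.exists_finite_residues (hR : IsLID R) {u : R} (hu : u ≠ 0) :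
    ∃ F : Set R, F.Finite ∧ ∀ v, ∃ r ∈ F, ∃ w, v = u * w + r := by
  have := hR.finiteIndex u hu
  set I := Submodule.toAddSubgroup (Ideal.span {u})
  have : Finite (R ⧸ I) := AddSubgroup.finite_quotient_of_finiteIndex
  refine ⟨Set.range (Quotient.out : R ⧸ I → R), Set.finite_range _, fun v => ?_⟩
  refine ⟨_, ⟨(v : R ⧸ I), rfl⟩, ?_⟩
  have h : ((Quotient.out (v : R ⧸ I) : R) : R ⧸ I) = v := QuotientAddGroup.out_eq' _
  have h2 : -(Quotient.out (v : R ⧸ I) : R) + v ∈ I := QuotientAddGroup.eq.1 h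
  obtain ⟨w, hw⟩ := Ideal.mem_span_singleton'.1 h2
  exact ⟨w, by linear_combination -hw⟩

/-- As `uR` has finite index, finitely many translates of `u • Y` form a subsystem; a minimal
subsystem inside it contains `u • Y` by minimality of `Y`. -/
theorem map_mul_mem_AMI (hR : IsLID R) {u : R} (hu : u ≠ 0) {q : Ultrafilter R} (hq : q ∈ AMI R) :
    q.map (fun x => u * x) ∈ AMI R := by
  obtain ⟨hnp, ⟨Y, hY, hqY⟩, hid⟩ := hq
  refine ⟨hnp.map (mul_right_injective₀ hu), ?_, ?_⟩
  · obtain ⟨F, hF, hres⟩ := hR.exists_finite_residues hu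
    have hsub : IsAddSubsystem
        (⋃ r ∈ F, (fun s : Ultrafilter R => s.map (fun x => u * x + r)) '' Y) := by
      refine ⟨?_, ?_, ?_⟩
      · obtain ⟨r, hr, -⟩ := hres 0
        exact ⟨_, Set.mem_biUnion hr (Set.mem_image_of_mem _ hqY)⟩
      · exact hF.isCompact_biUnion fun r _ =>
          hY.1.2.1.image (Ultrafilter.continuous_map_self _)
      · intro v s hs
        obtain ⟨r, hr, t, ht, rfl⟩ := Set.mem_iUnion₂.1 hs
        obtain ⟨r', hr', w, hw⟩ := hres (r + v)
        refine Set.mem_biUnion hr' ⟨_, hY.1.2.2 w t ht, ?_⟩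
        simp only [Ultrafilter.map_map, Function.comp_def]
        congr 1
        ext x
        linear_combination -hw
    obtain ⟨N, hN, hmin⟩ := hsub.exists_minimal
    refine ⟨N, hmin, ?_⟩
    have hZ : IsAddSubsystem (Y ∩ {s : Ultrafilter R | s.map (fun x => u * x) ∈ N}) := by
      refine ⟨?_, hY.1.2.1.inter_right
        (hmin.1.2.1.isClosed.preimage (Ultrafilter.continuous_map_self _)), ?_⟩
      · obtain ⟨s, hs⟩ := hmin.1.1
        obtain ⟨r, hr, t, ht, rfl⟩ := Set.mem_iUnion₂.1 (hN hs)
        refine ⟨t, ht, ?_⟩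
        simpa [Ultrafilter.map_map, Function.comp_def] using! hmin.1.2.2 (-r) _ hs
      · rintro v s ⟨hs, hs'⟩
        refine ⟨hY.1.2.2 v s hs, ?_⟩
        have := hmin.1.2.2 (u * v) _ hs'
        simpa [Ultrafilter.map_map, Function.comp_def, mul_add] using! this
    exact (hY.2 hZ Set.inter_subset_left hqY).2
  · refine Ultrafilter.ext fun E => ?_
    have h : {x | u * x ∈ E} ∈ ultraAdd q q ↔ {x | u * x ∈ E} ∈ q := by rw [hid]
    rw [mem_ultraAdd] at h
    rw [mem_ultraAdd]
    simpa [mul_add] using! h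

theorem map_mul_mem_closure_AMI (hR : IsLID R) {u : R} (hu : u ≠ 0) {q : Ultrafilter R}
    (hq : q ∈ closure (AMI R)) : q.map (fun x => u * x) ∈ closure (AMI R) :=
  map_mem_closure (Ultrafilter.continuous_map_self _) hq fun _ h => map_mul_mem_AMI hR hu h

/-! ### Sets in every ultrafilter of the class `ultraG` are affinely syndetic -/

/-- Otherwise, by compactness, the ultrafilters all of whose affine images avoid `S` form a
non-empty compact set invariant under the affine semigroup. Its intersection with the closure of
`AMI` is a multiplicative subsystem, and an idempotent of a minimal subsystem inside it belongs to
`ultraG R` but does not contain `S`. -/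
theorem isAffinelySyndetic_of_forall_mem_ultraG (hR : IsLID R) {S : Set R}
    (hS : ∀ p ∈ ultraG R, S ∈ p) : IsAffinelySyndetic S := by
  have := hR.infinite
  have hopen : ∀ g : affineSemigroup R,
      IsOpen {q : Ultrafilter R | S ∈ q.map (g : Function.End R)} := fun g =>
    ultrafilter_isOpen_basic _
  by_cases hcov : Set.univ ⊆ ⋃ g : affineSemigroup R,
      {q : Ultrafilter R | S ∈ q.map (g : Function.End R)}
  · obtain ⟨t, ht⟩ := isCompact_univ.elim_finite_subcover _ hopen hcov
    refine ⟨t, t.finite_toSet, Set.eq_univ_of_forall fun x => ?_⟩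
    obtain ⟨g, hg, hmem⟩ := Set.mem_iUnion₂.1 (ht (Set.mem_univ (pure x : Ultrafilter R)))
    exact Set.mem_biUnion hg hmem
  exfalso
  obtain ⟨q₀, hq₀⟩ : ∃ q : Ultrafilter R, ∀ g : affineSemigroup R,
      S ∉ q.map (g : Function.End R) := by
    by_contra! h
    exact hcov fun q _ => Set.mem_iUnion.2 (h q)
  set Z : Set (Ultrafilter R) := {q | ∀ g : affineSemigroup R, S ∉ q.map (g : Function.End R)}
    with hZdef
  have hZc : IsClosed Z := by
    rw [hZdef]
    simp only [Set.ofPred_forall]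
    exact isClosed_iInter fun g => (hopen g).isClosed_compl
  have hZinv : ∀ h : affineSemigroup R, ∀ q ∈ Z, q.map (h : Function.End R) ∈ Z :=
    fun h q hq g => hq (g * h)
  obtain ⟨q, hqZ, hq⟩ := IsAddSubsystem.exists_mem_AMI (Y := Z)
    ⟨⟨q₀, hq₀⟩, hZc.isCompact, fun v => hZinv (affAdd v)⟩
  have hW : IsMulSubsystem (Z ∩ closure (AMI R)) :=
    ⟨⟨q, hqZ, subset_closure hq⟩, (hZc.inter isClosed_closure).isCompact,
      fun s hs => nonPrincipal_of_mem_closure_AMI hs.2 0,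
      fun u hu s hs => ⟨hZinv (affMul u hu) s hs.1, map_mul_mem_closure_AMI hR hu hs.2⟩⟩
  obtain ⟨N, hN, hmin⟩ := hW.exists_minimal
  obtain ⟨p, hp, hid⟩ := hmin.1.exists_idempotent
  have hpW := hN hp
  refine hpW.1 1 (hS p ⟨hpW.2, nonPrincipal_of_mem_closure_AMI hpW.2, ⟨N, hmin, hp⟩, hid⟩)

end Ring

/-! ### Limits along ultrafilters in Hilbert spaces -/

theorem Ultrafilter.exists_tendsto_of_abs_le {ι : Type*} (p : Ultrafilter ι) {φ : ι → ℝ} {C : ℝ}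
    (h : ∀ᶠ i in p, |φ i| ≤ C) : ∃ l, Tendsto φ p (𝓝 l) := by
  obtain ⟨l, -, hl⟩ := (isCompact_Icc (a := -C) (b := C)).ultrafilter_le_nhds' (p.map φ)
    (h.mono fun i hi => abs_le.1 hi)
  exact ⟨l, hl⟩

/-- Iterated limits along an ultrafilter `p` that is idempotent for the operation `op`. -/
theorem tendsto_of_tendsto_iterated {ι Z : Type*} [TopologicalSpace Z] [RegularSpace Z]
    {p : Ultrafilter ι} {op : ι → ι → ι} (hp : ∀ E ∈ p, ∀ᶠ u in p, ∀ᶠ v in p, op u v ∈ E)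
    {φ ψ : ι → Z} {l : Z} (hφ : Tendsto φ p (𝓝 l))
    (hψ : ∀ᶠ u in p, Tendsto (fun v => φ (op u v)) p (𝓝 (ψ u))) : Tendsto ψ p (𝓝 l) := by
  refine (closed_nhds_basis l).tendsto_right_iff.2 fun U hU => ?_
  filter_upwards [hp _ (hφ hU.1), hψ] with u hu hu'
  exact hU.2.mem_of_tendsto hu' hu

section Hilbert

variable {H : Type*} [NormedAddCommGroup H] [InnerProductSpace ℝ H]

theorem Ultrafilter.exists_weak_limit [CompleteSpace H] {ι : Type*} (p : Ultrafilter ι) {x : ι → H}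
    {C : ℝ} (hx : ∀ᶠ i in p, ‖x i‖ ≤ C) :
    ∃ y : H, ∀ z, Tendsto (fun i => inner ℝ (x i) z) p (𝓝 (inner ℝ y z)) := by
  have hbound : ∀ z, ∀ᶠ i in p, |inner ℝ (x i) z| ≤ C * ‖z‖ := fun z => hx.mono fun i hi =>
    (abs_real_inner_le_norm _ _).trans (by gcongr)
  choose l hl using fun z => p.exists_tendsto_of_abs_le (hbound z)
  let L : H →ₗ[ℝ] ℝ :=
    { toFun := l
      map_add' := fun z w => tendsto_nhds_unique (hl (z + w)) <| by
        simpa only [inner_add_right] using (hl z).add (hl w)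
      map_smul' := fun c z => tendsto_nhds_unique (hl (c • z)) <| by
        simpa only [real_inner_smul_right, smul_eq_mul, RingHom.id_apply]
          using (hl z).const_mul c }
  let L' : H →L[ℝ] ℝ := L.mkContinuous C fun z => le_of_tendsto (hl z).abs (hbound z)
  refine ⟨(InnerProductSpace.toDual ℝ H).symm L', fun z => ?_⟩
  rw [InnerProductSpace.toDual_symm_apply]
  exact hl z

/-- Weak convergence to `y` of vectors of norm `‖y‖` is norm convergence. -/
theorem tendsto_of_tendsto_inner_self {ι : Type*} {l : Filter ι} {x : ι → H} {y : H}
    (hnorm : ∀ᶠ i in l, ‖x i‖ = ‖y‖)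
    (hx : Tendsto (fun i => inner ℝ (x i) y) l (𝓝 (inner ℝ y y))) : Tendsto x l (𝓝 y) := by
  rw [tendsto_iff_norm_sub_tendsto_zero]
  have h : Tendsto (fun i => 2 * ‖y‖ ^ 2 - 2 * inner ℝ (x i) y) l (𝓝 0) := by
    have := (hx.const_mul 2).const_sub (2 * ‖y‖ ^ 2)
    rwa [real_inner_self_eq_norm_sq, sub_self] at this
  have h2 : Tendsto (fun i => ‖x i - y‖ ^ 2) l (𝓝 0) := by
    refine h.congr' (hnorm.mono fun i hi => ?_)
    simp only [norm_sub_sq_real, hi]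
    ring
  simpa using h2.sqrt

/-! ### Affine families of isometries -/

variable {R : Type*} [CommRing R]

/-- Linear operators `A v` (`v ∈ R`) and `M u` (`u ∈ R \ {0}`) on a real Hilbert space, all of them
isometric, such that `A` is a representation of `(R, +)`, `M` is one of `(R \ {0}, ·)`, and
`A v * M u = M u * A (u * v)`: the relations satisfied by the composition operators of a measure
preserving action of the affine semigroup. The operator `M 0` is unconstrained. -/
structure IsAffineFamily (A M : R → H →L[ℝ] H) : Prop where
  zero : ∀ f, A 0 f = f
  add : ∀ u v f, A (u + v) f = A u (A v f)
  mul : ∀ u v, u ≠ 0 → v ≠ 0 → ∀ f, M (u * v) f = M u (M v f)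
  comm : ∀ v u, u ≠ 0 → ∀ f, A v (M u f) = M u (A (u * v) f)
  norm_add : ∀ v f, ‖A v f‖ = ‖f‖
  norm_mul : ∀ u, u ≠ 0 → ∀ f, ‖M u f‖ = ‖f‖

/-- The vectors whose orbit under the operators `A v` is relatively compact. -/
def almostPeriodic (A : R → H →L[ℝ] H) : Submodule ℝ H where
  carrier := {f | ∃ C : Set H, IsCompact C ∧ ∀ v, A v f ∈ C}
  zero_mem' := ⟨{0}, isCompact_singleton, fun v => by simp⟩
  add_mem' := by
    rintro f g ⟨C, hC, hf⟩ ⟨D, hD, hg⟩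
    exact ⟨C + D, hC.add hD, fun v => by
      rw [map_add]
      exact Set.add_mem_add (hf v) (hg v)⟩
  smul_mem' := by
    rintro c f ⟨C, hC, hf⟩
    exact ⟨c • C, hC.smul c, fun v => by
      rw [map_smul]
      exact Set.smul_mem_smul_set (hf v)⟩

namespace IsAffineFamily

variable {A M : R → H →L[ℝ] H} (h : IsAffineFamily A M)
include h

theorem inner_add (v : R) (f g : H) : inner ℝ (A v f) (A v g) = inner ℝ f g := by
  simp only [real_inner_eq_norm_add_mul_self_sub_norm_mul_self_sub_norm_mul_self_div_two,
    ← map_add, h.norm_add]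

theorem inner_mul {u : R} (hu : u ≠ 0) (f g : H) : inner ℝ (M u f) (M u g) = inner ℝ f g := by
  simp only [real_inner_eq_norm_add_mul_self_sub_norm_mul_self_sub_norm_mul_self_div_two,
    ← map_add, h.norm_mul u hu]

theorem inner_left (v : R) (f g : H) : inner ℝ (A v f) g = inner ℝ f (A (-v) g) := by
  rw [← h.inner_add (-v), ← h.add, neg_add_cancel, h.zero]

theorem adjoint_add [CompleteSpace H] {u : R} (hu : u ≠ 0) (v : R) (f : H) :
    (M u).adjoint (A v f) = A (u * v) ((M u).adjoint f) := by
  refine ext_inner_right ℝ fun g => ?_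
  rw [ContinuousLinearMap.adjoint_inner_left, h.inner_left, h.comm _ _ hu, h.inner_left,
    ContinuousLinearMap.adjoint_inner_left, mul_neg]

theorem norm_adjoint_le [CompleteSpace H] {u : R} (hu : u ≠ 0) (f : H) :
    ‖(M u).adjoint f‖ ≤ ‖f‖ := by
  refine (ContinuousLinearMap.le_opNorm _ _).trans ?_
  rw [LinearIsometryEquiv.norm_map]
  refine mul_le_of_le_one_left (norm_nonneg f) ?_
  exact ContinuousLinearMap.opNorm_le_bound _ zero_le_one fun g => by rw [h.norm_mul u hu, one_mul]

/-! ### The almost periodic part -/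

theorem isClosed_almostPeriodic [CompleteSpace H] : IsClosed (almostPeriodic A : Set H) := by
  refine isClosed_of_closure_subset fun f hf => ?_
  refine ⟨closure (Set.range fun v => A v f), ?_, fun v => subset_closure ⟨v, rfl⟩⟩
  refine (TotallyBounded.closure ?_).isCompact_of_isClosed isClosed_closure
  refine Metric.totallyBounded_iff.2 fun ε hε => ?_
  obtain ⟨g, ⟨C, hC, hg⟩, hfg⟩ := Metric.mem_closure_iff.1 hf (ε / 2) (half_pos hε)
  obtain ⟨t, ht, hCt⟩ := Metric.totallyBounded_iff.1 hC.totallyBounded (ε / 2) (half_pos hε)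
  refine ⟨t, ht, ?_⟩
  rintro _ ⟨v, rfl⟩
  obtain ⟨y, hy, hvy⟩ := Set.mem_iUnion₂.1 (hCt (hg v))
  refine Set.mem_biUnion hy ?_
  rw [Metric.mem_ball] at hvy ⊢
  have : dist (A v f) (A v g) = dist f g := by
    rw [dist_eq_norm, dist_eq_norm, ← map_sub, h.norm_add]
  linarith [dist_triangle (A v f) (A v g) y]

theorem add_mem_almostPeriodic (v : R) {f : H} (hf : f ∈ almostPeriodic A) :
    A v f ∈ almostPeriodic A := by
  obtain ⟨C, hC, hf⟩ := hf
  exact ⟨C, hC, fun w => by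
    rw [← h.add]
    exact hf _⟩

theorem mul_mem_almostPeriodic {u : R} (hu : u ≠ 0) {f : H} (hf : f ∈ almostPeriodic A) :
    M u f ∈ almostPeriodic A := by
  obtain ⟨C, hC, hf⟩ := hf
  exact ⟨M u '' C, hC.image (M u).continuous, fun w => by
    rw [h.comm _ _ hu]
    exact Set.mem_image_of_mem _ (hf _)⟩

theorem adjoint_mem_orthogonal [CompleteSpace H] {u : R} (hu : u ≠ 0) {f : H}
    (hf : f ∈ (almostPeriodic A)ᗮ) : (M u).adjoint f ∈ (almostPeriodic A)ᗮ := by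
  rw [Submodule.mem_orthogonal] at hf ⊢
  intro k hk
  rw [ContinuousLinearMap.adjoint_inner_right]
  exact hf _ (h.mul_mem_almostPeriodic hu hk)

/-- Along an additive idempotent, almost periodic vectors are recurrent. -/
theorem tendsto_of_mem_almostPeriodic {q : Ultrafilter R} (hq : ultraAdd q q = q) {f : H}
    (hf : f ∈ almostPeriodic A) : Tendsto (fun u => A u f) q (𝓝 f) := by
  obtain ⟨C, hC, hfC⟩ := hf
  obtain ⟨y, -, hy⟩ : ∃ y ∈ C, Tendsto (fun u => A u f) q (𝓝 y) :=
    hC.ultrafilter_le_nhds' (q.map fun u => A u f)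
      (show ∀ᶠ u in q, A u f ∈ C from Eventually.of_forall hfC)
  have hidem : ∀ E ∈ q, ∀ᶠ u in q, ∀ᶠ v in q, u + v ∈ E := fun E hE =>
    (mem_ultraAdd q q E).1 (hq.symm ▸ hE)
  have hy' : Tendsto (fun u => A u y) q (𝓝 y) := by
    refine tendsto_of_tendsto_iterated hidem hy (Eventually.of_forall fun u => ?_)
    simp only [h.add]
    exact ((A u).continuous.tendsto y).comp hy
  have hdiff : Tendsto (fun _ : R => ‖f - y‖) q (𝓝 0) := by
    have := (hy.sub hy').norm
    rw [sub_self, norm_zero] at this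
    refine this.congr fun u => ?_
    rw [← map_sub, h.norm_add]
  have h0 := tendsto_nhds_unique tendsto_const_nhds hdiff
  rw [norm_eq_zero, sub_eq_zero] at h0
  rwa [← h0] at hy

/-! ### Dilations along a multiplicative idempotent -/

/-- The weak limit `y` of `M u f` along a multiplicative idempotent is invariant in the limit, so
that `⟪M u f, f⟫` tends to `⟪y, f⟫ = ‖y‖ ^ 2`, and `y` has the same component as `f` along an
invariant vector `e`. -/
theorem exists_tendsto_inner_mul [CompleteSpace H] {p : Ultrafilter R}
    (hpp : ultraMul p p = p) (hp0 : p ≠ pure 0) (f : H) {e : H} (he : ‖e‖ = 1)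
    (hMe : ∀ u, u ≠ 0 → M u e = e) :
    ∃ L, inner ℝ f e ^ 2 ≤ L ∧ Tendsto (fun u => inner ℝ (M u f) f) p (𝓝 L) := by
  have hne : ∀ᶠ u : R in p, u ≠ 0 := Ultrafilter.ne_pure_iff.1 hp0
  obtain ⟨y, hy⟩ := p.exists_weak_limit (x := fun u => M u f) (C := ‖f‖)
    (hne.mono fun u hu => (h.norm_mul u hu f).le)
  have hidem : ∀ E ∈ p, ∀ᶠ u in p, ∀ᶠ v in p, u * v ∈ E := fun E hE =>
    (mem_ultraMul p p E).1 (hpp.symm ▸ hE)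
  have hMy : Tendsto (fun u => M u y) p (𝓝 y) := by
    refine tendsto_of_tendsto_inner_self (hne.mono fun u hu => h.norm_mul u hu y) ?_
    refine tendsto_of_tendsto_iterated hidem (hy y) (hne.mono fun u hu => ?_)
    rw [← ContinuousLinearMap.adjoint_inner_right]
    refine (hy _).congr' (hne.mono fun v hv => ?_)
    simp only
    rw [h.mul u v hu hv, ContinuousLinearMap.adjoint_inner_right]
  have hfy : inner ℝ y f = ‖y‖ ^ 2 := by
    have h1 : Tendsto (fun u => inner ℝ (M u f) (M u y - y)) p (𝓝 0) := by
      have h2 : Tendsto (fun u => ‖f‖ * ‖M u y - y‖) p (𝓝 0) := by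
        have := (hMy.sub_const y).norm.const_mul ‖f‖
        rwa [sub_self, norm_zero, mul_zero] at this
      refine squeeze_zero_norm' (hne.mono fun u hu => ?_) h2
      rw [← h.norm_mul u hu f]
      exact norm_inner_le_norm _ _
    have h3 := h1.add (hy y)
    rw [zero_add, real_inner_self_eq_norm_sq] at h3
    refine tendsto_nhds_unique (tendsto_const_nhds.congr' (hne.mono fun u hu => ?_)) h3
    rw [← _root_.inner_add_right, sub_add_cancel, h.inner_mul hu, real_inner_comm]
  have hye : inner ℝ f e = inner ℝ y e := by
    refine tendsto_nhds_unique (tendsto_const_nhds.congr' (hne.mono fun u hu => ?_)) (hy e)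
    rw [← h.inner_mul hu, hMe u hu]
  refine ⟨‖y‖ ^ 2, ?_, hfy ▸ hy f⟩
  rw [hye, ← sq_abs]
  refine pow_le_pow_left₀ (abs_nonneg _) ?_ 2
  simpa [he] using abs_real_inner_le_norm y e

/-! ### Orthogonality of weakly mixing vectors -/

variable [IsDomain R]

/-- As `cR` has finite index, it suffices that the orbit under `cR` is relatively compact. -/
theorem mem_almostPeriodic_of_mul (hR : IsLID R) {c : R} (hc : c ≠ 0) {f : H} {C : Set H}
    (hC : IsCompact C) (hf : ∀ w, A (c * w) f ∈ C) : f ∈ almostPeriodic A := by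
  obtain ⟨F, hF, hres⟩ := hR.exists_finite_residues hc
  refine ⟨⋃ r ∈ F, A r '' C, hF.isCompact_biUnion fun r _ => hC.image (A r).continuous,
    fun v => ?_⟩
  obtain ⟨r, hr, w, rfl⟩ := hres v
  rw [add_comm, h.add]
  exact Set.mem_biUnion hr (Set.mem_image_of_mem _ (hf w))

variable [CompleteSpace H]

theorem adjoint_mem_almostPeriodic (hR : IsLID R) {u : R} (hu : u ≠ 0) {f : H}
    (hf : f ∈ almostPeriodic A) : (M u).adjoint f ∈ almostPeriodic A := by
  obtain ⟨C, hC, hf⟩ := hf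
  refine h.mem_almostPeriodic_of_mul hR hu (hC.image (M u).adjoint.continuous) fun w => ?_
  rw [← h.adjoint_add hu]
  exact Set.mem_image_of_mem _ (hf w)

theorem mul_mem_orthogonal (hR : IsLID R) {u : R} (hu : u ≠ 0) {f : H}
    (hf : f ∈ (almostPeriodic A)ᗮ) : M u f ∈ (almostPeriodic A)ᗮ := by
  rw [Submodule.mem_orthogonal] at hf ⊢
  intro k hk
  rw [← ContinuousLinearMap.adjoint_inner_left]
  exact hf _ (h.adjoint_mem_almostPeriodic hR hu hk)

/-- If `A (c * u) y` returns to `y` along an additive minimal idempotent, then it does so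
syndetically often, and therefore `y` is almost periodic. -/
theorem mem_almostPeriodic_of_tendsto (hR : IsLID R) {c : R} (hc : c ≠ 0) {q : Ultrafilter R}
    (hq : q ∈ AMI R) {y : H} (hy : Tendsto (fun u => A (c * u) y) q (𝓝 y)) :
    y ∈ almostPeriodic A := by
  obtain ⟨-, ⟨Y, hY, hqY⟩, -⟩ := hq
  suffices htb : TotallyBounded (Set.range fun w => A (c * w) y) from
    h.mem_almostPeriodic_of_mul hR hc (htb.closure.isCompact_of_isClosed isClosed_closure)
      fun w => subset_closure ⟨w, rfl⟩
  refine Metric.totallyBounded_iff.2 fun ε hε => ?_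
  have hE : {u | dist (A (c * u) y) y < ε / 2} ∈ q :=
    hy (Metric.ball_mem_nhds y (half_pos hε))
  obtain ⟨F, hF, hret⟩ := exists_finite_return_of_mem_minimal hY hqY hE
  refine ⟨(fun v => A (c * -v) y) '' F, hF.image _, ?_⟩
  rintro _ ⟨w, rfl⟩
  obtain ⟨v, hv, hwv⟩ := hret w
  obtain ⟨x, hx1, hx2⟩ := (hwv.and hE).exists
  refine Set.mem_biUnion (Set.mem_image_of_mem _ hv) ?_
  -- the isometry `A (c * (x + v))` reduces the claim to the two returns `hx1` and `hx2`
  have key : dist (A (c * w) y) (A (c * -v) y) = dist (A (c * (x + (w + v))) y) (A (c * x) y) := by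
    have e1 : c * (x + (w + v)) = c * (x + v) + c * w := by ring
    have e2 : c * x = c * (x + v) + c * -v := by ring
    rw [e1, e2, h.add, h.add, dist_eq_norm, dist_eq_norm, ← map_sub, h.norm_add]
  rw [Metric.mem_ball, key]
  have hx1' : dist (A (c * (x + (w + v))) y) y < ε / 2 := hx1
  have hx2' : dist (A (c * x) y) y < ε / 2 := hx2
  linarith [dist_triangle_right (A (c * (x + (w + v))) y) (A (c * x) y) y]

/-- Vectors orthogonal to the almost periodic ones are weakly mixing: the weak limit `y` of
`A (c * u) f` satisfies `A (c * u) y → y`, hence it is both almost periodic and orthogonal to the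
almost periodic vectors. -/
theorem tendsto_inner_zero_of_mem_AMI (hR : IsLID R) {c : R} (hc : c ≠ 0) {q : Ultrafilter R}
    (hq : q ∈ AMI R) {f : H} (hf : f ∈ (almostPeriodic A)ᗮ) (g : H) :
    Tendsto (fun u => inner ℝ (A (c * u) f) g) q (𝓝 0) := by
  obtain ⟨y, hy⟩ := q.exists_weak_limit (x := fun u => A (c * u) f) (C := ‖f‖)
    (Eventually.of_forall fun u => (h.norm_add _ _).le)
  have hidem : ∀ E ∈ q, ∀ᶠ u in q, ∀ᶠ v in q, u + v ∈ E := fun E hE =>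
    (mem_ultraAdd q q E).1 (hq.2.2.symm ▸ hE)
  have hyy : Tendsto (fun u => inner ℝ (A (c * u) y) y) q (𝓝 (inner ℝ y y)) := by
    refine tendsto_of_tendsto_iterated hidem (hy y) (Eventually.of_forall fun u => ?_)
    simp only [mul_add, h.add, h.inner_left (c * u)]
    exact hy _
  have hyK : y ∈ almostPeriodic A := h.mem_almostPeriodic_of_tendsto hR hc hq
    (tendsto_of_tendsto_inner_self (Eventually.of_forall fun u => h.norm_add _ _) hyy)
  have hy0 : inner ℝ y y = 0 := by
    refine tendsto_nhds_unique (hy y) (tendsto_const_nhds.congr fun u => ?_)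
    rw [h.inner_left, real_inner_comm]
    exact ((Submodule.mem_orthogonal _ _).1 hf _ (h.add_mem_almostPeriodic _ hyK)).symm
  have := hy g
  rwa [inner_self_eq_zero.1 hy0, inner_zero_left] at this

/-! ### Correlations of translates with dilates -/

variable {p : Ultrafilter R} (hp : p ∈ closure (AMI R)) (hpp : ultraMul p p = p)
include hp hpp

/-- For `b ≠ 0` one has `⟪A (b * u) f, M (b * u) g⟫ = ⟪A (b ^ 2 * u) f_b, M u g⟫` with
`f_b = (M b)† f`. By idempotence of `p` the limit `L` of the correlations is, up to `|L| / 2`, the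
limit of the left-hand side for infinitely many `b`; averaging over `n` of these and using that the
vectors `A (b ^ 2 * u) f_b` become orthogonal bounds `L ^ 2` by a multiple of `1 / n`. -/
theorem tendsto_correlation_zero (hR : IsLID R) {f : H} (hf : f ∈ (almostPeriodic A)ᗮ) (g : H) :
    Tendsto (fun u => inner ℝ (A u f) (M u g)) p (𝓝 0) := by
  have hnp := nonPrincipal_of_mem_closure_AMI hp
  have hne : ∀ᶠ u : R in p, u ≠ 0 := Ultrafilter.ne_pure_iff.1 (hnp 0)
  set φ : R → ℝ := fun u => inner ℝ (A u f) (M u g) with hφ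
  obtain ⟨L, hL⟩ := p.exists_tendsto_of_abs_le (φ := φ) (C := ‖f‖ * ‖g‖) <| hne.mono fun u hu =>
    (abs_real_inner_le_norm _ _).trans (by rw [h.norm_add, h.norm_mul u hu])
  suffices hL0 : L = 0 by rwa [hL0] at hL
  by_contra hL0
  have hLpos : 0 < |L| := abs_pos.2 hL0
  set E : Set R := {b | b ≠ 0 ∧ ∀ᶠ u in p, |φ (b * u) - L| < |L| / 2}
  have hE : E ∈ p := by
    have hball : {u | |φ u - L| < |L| / 2} ∈ p := hL (Metric.ball_mem_nhds L (half_pos hLpos))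
    rw [← hpp, mem_ultraMul] at hball
    filter_upwards [hne, hball] with b hb hb'
    exact ⟨hb, hb'⟩
  have hsq : ((fun b : R => b ^ 2) '' E).Infinite := by
    refine fun hfin => hnp.infinite_of_mem hE (hfin.of_finite_fibers _ fun a _ => ?_)
    rcases Set.eq_empty_or_nonempty (E ∩ (fun b : R => b ^ 2) ⁻¹' {a}) with he | ⟨b, -, hb⟩
    · rw [he]
      exact Set.finite_empty
    · refine (Set.toFinite {b, -b}).subset fun x hx => ?_
      have : x ^ 2 = b ^ 2 := hx.2.trans hb.symm
      exact sq_eq_sq_iff_eq_or_eq_neg.1 this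
  obtain ⟨E', hE'E, hbij⟩ := Set.exists_subset_bijOn E (fun b : R => b ^ 2)
  have hE'inf : E'.Infinite := fun hfin => hsq (hbij.image_eq ▸ hfin.image _)
  have hbound : ∀ n : ℕ, (n * (|L| / 2)) ^ 2 ≤ n * (‖f‖ ^ 2 * ‖g‖ ^ 2) := by
    intro n
    classical
    obtain ⟨B, hBE', hBcard⟩ := hE'inf.exists_subset_card_eq n
    have hB : ∀ b ∈ B, b ≠ 0 ∧ ∀ᶠ u in p, |φ (b * u) - L| < |L| / 2 := fun b hb =>
      hE'E (hBE' hb)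
    set x : R → R → H := fun b u => A (b ^ 2 * u) ((M b).adjoint f)
    have hcorr : ∀ b ∈ B, ∀ u ≠ 0, φ (b * u) = inner ℝ (x b u) (M u g) := by
      intro b hb u hu
      have hb0 := (hB b hb).1
      have e : b ^ 2 * u = b * (b * u) := by ring
      rw [hφ]
      simp only [x]
      rw [h.mul _ _ hb0 hu, e, ← h.adjoint_add hb0, ContinuousLinearMap.adjoint_inner_left]
    have hlow : ∀ᶠ u in p, (n * (|L| / 2)) ^ 2 ≤ ‖∑ b ∈ B, x b u‖ ^ 2 * ‖g‖ ^ 2 := by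
      filter_upwards [hne, (Filter.eventually_all_finset B).2 fun b hb => (hB b hb).2] with u hu hu'
      have h1 : |∑ b ∈ B, φ (b * u) - n * L| ≤ n * (|L| / 2) := by
        have : ∑ b ∈ B, φ (b * u) - n * L = ∑ b ∈ B, (φ (b * u) - L) := by
          rw [Finset.sum_sub_distrib, Finset.sum_const, hBcard, nsmul_eq_mul]
        rw [this]
        refine (Finset.abs_sum_le_sum_abs _ _).trans ?_
        refine (Finset.sum_le_card_nsmul B _ _ fun b hb => (hu' b hb).le).trans ?_
        rw [hBcard, nsmul_eq_mul]
      have h2 : |∑ b ∈ B, φ (b * u)| ≤ ‖∑ b ∈ B, x b u‖ * ‖g‖ := by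
        rw [Finset.sum_congr rfl fun b hb => hcorr b hb u hu, ← sum_inner, ← h.norm_mul u hu g]
        exact abs_real_inner_le_norm _ _
      have h3 : n * |L| = |(n : ℝ) * L| := by rw [abs_mul, Nat.abs_cast]
      have h4 := abs_sub_abs_le_abs_sub ((n : ℝ) * L) (∑ b ∈ B, φ (b * u))
      rw [abs_sub_comm] at h4
      rw [← mul_pow]
      refine pow_le_pow_left₀ (by positivity) ?_ 2
      linarith
    have hlim : Tendsto (fun u => ‖∑ b ∈ B, x b u‖ ^ 2) p
        (𝓝 (∑ b ∈ B, ‖(M b).adjoint f‖ ^ 2)) := by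
      have hexp : ∀ u, ‖∑ b ∈ B, x b u‖ ^ 2 = ∑ b ∈ B, ∑ b' ∈ B, inner ℝ (x b u) (x b' u) := by
        intro u
        rw [← real_inner_self_eq_norm_sq, sum_inner]
        simp only [inner_sum]
      simp only [hexp]
      refine tendsto_finsetSum B fun b hb => ?_
      have hsum : ‖(M b).adjoint f‖ ^ 2 =
          ∑ b' ∈ B, if b = b' then ‖(M b).adjoint f‖ ^ 2 else 0 := by
        rw [Finset.sum_ite_eq, if_pos hb]
      rw [hsum]
      refine tendsto_finsetSum B fun b' hb' => ?_
      split_ifs with hbb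
      · subst hbb
        refine tendsto_const_nhds.congr fun u => ?_
        rw [real_inner_self_eq_norm_sq, h.norm_add]
      · have hc : b ^ 2 - b' ^ 2 ≠ 0 := fun h0 =>
          hbb (hbij.injOn (hBE' hb) (hBE' hb') (sub_eq_zero.1 h0))
        refine (tendsto_of_mem_closure (fun q hq => h.tendsto_inner_zero_of_mem_AMI hR hc hq
          (h.adjoint_mem_orthogonal (hB b hb).1 hf) ((M b').adjoint f)) hp).congr fun u => ?_
        simp only [x]
        rw [← h.inner_add (b' ^ 2 * u), ← h.add]
        congr 2
        congr 1
        ring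
    have h5 : (n * (|L| / 2)) ^ 2 ≤ (∑ b ∈ B, ‖(M b).adjoint f‖ ^ 2) * ‖g‖ ^ 2 :=
      ge_of_tendsto (hlim.mul_const _) hlow
    have h6 : ∑ b ∈ B, ‖(M b).adjoint f‖ ^ 2 ≤ n * ‖f‖ ^ 2 := by
      refine (Finset.sum_le_card_nsmul B _ (‖f‖ ^ 2) fun b hb => ?_).trans ?_
      · exact pow_le_pow_left₀ (norm_nonneg _) (h.norm_adjoint_le (hB b hb).1 f) 2
      · rw [hBcard, nsmul_eq_mul]
    calc (n * (|L| / 2)) ^ 2 ≤ n * ‖f‖ ^ 2 * ‖g‖ ^ 2 := h5.trans (by gcongr)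
      _ = n * (‖f‖ ^ 2 * ‖g‖ ^ 2) := by ring
  obtain ⟨n, hn⟩ := exists_nat_gt (‖f‖ ^ 2 * ‖g‖ ^ 2 / (|L| / 2) ^ 2)
  have hn0 : (0 : ℝ) < n := lt_of_le_of_lt (by positivity) hn
  rw [div_lt_iff₀ (by positivity)] at hn
  have h7 : (n : ℝ) * (‖f‖ ^ 2 * ‖g‖ ^ 2) < n * (n * (|L| / 2) ^ 2) := by gcongr
  have h8 := hbound n
  have h9 : (n * (|L| / 2)) ^ 2 = n * (n * (|L| / 2) ^ 2) := by ring
  linarith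

/-- Along `p` only the almost periodic part `k` of `f` contributes, and for it the correlation
reduces to `⟪M u k, k⟫`. -/
theorem exists_tendsto_correlation (hR : IsLID R) (f : H) {e : H} (he : ‖e‖ = 1)
    (hAe : ∀ v, A v e = e) (hMe : ∀ u, u ≠ 0 → M u e = e) :
    ∃ L, inner ℝ f e ^ 2 ≤ L ∧ Tendsto (fun u => inner ℝ (A u f) (M u f)) p (𝓝 L) := by
  have hp0 := nonPrincipal_of_mem_closure_AMI hp 0
  have hne : ∀ᶠ u : R in p, u ≠ 0 := Ultrafilter.ne_pure_iff.1 hp0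
  have : CompleteSpace (almostPeriodic A) := h.isClosed_almostPeriodic.completeSpace_coe
  obtain ⟨k, hk, w, hw, rfl⟩ := (almostPeriodic A).exists_add_mem_mem_orthogonal f
  obtain ⟨L, hL, hlim⟩ := h.exists_tendsto_inner_mul hpp hp0 k he hMe
  have heK : e ∈ almostPeriodic A := ⟨{e}, isCompact_singleton, fun v => by simp [hAe v]⟩
  have hwe : inner ℝ w e = 0 := (Submodule.mem_orthogonal' _ _).1 hw e heK
  refine ⟨L, by rwa [_root_.inner_add_left, hwe, add_zero], ?_⟩
  have hAk : Tendsto (fun u => A u k) p (𝓝 k) :=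
    tendsto_of_mem_closure (fun q hq => h.tendsto_of_mem_almostPeriodic hq.2.2 hk) hp
  have h1 : Tendsto (fun u => inner ℝ (A u k - k) (M u (k + w))) p (𝓝 0) := by
    have h2 : Tendsto (fun u => ‖A u k - k‖ * ‖k + w‖) p (𝓝 0) := by
      have := (hAk.sub_const k).norm.mul_const ‖k + w‖
      rwa [sub_self, norm_zero, zero_mul] at this
    refine squeeze_zero_norm' (hne.mono fun u hu => ?_) h2
    rw [← h.norm_mul u hu (k + w)]
    exact norm_inner_le_norm _ _
  have h3 := (h1.add (h.tendsto_correlation_zero hp hpp hR hw (k + w))).add hlim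
  rw [zero_add, zero_add] at h3
  refine h3.congr' (hne.mono fun u hu => ?_)
  have h4 : inner ℝ k (M u w) = 0 :=
    (Submodule.mem_orthogonal _ _).1 (h.mul_mem_orthogonal hR hu hw) k hk
  rw [real_inner_comm k]
  simp only [map_add, inner_sub_left, _root_.inner_add_left, _root_.inner_add_right, h4]
  ring

end IsAffineFamily

end Hilbert

/-! ### The composition operators of a measure preserving action -/

section Koopman

variable {G Ω : Type*} [MeasurableSpace Ω] {μ : Measure Ω} {T : G → Ω → Ω}

/-- The operator `f ↦ f ∘ T g` on `L²(μ)`. -/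
noncomputable def koopman [Semigroup G] (hT : IsMeasurePreservingAction μ T) (g : G) :
    Lp ℝ 2 μ →L[ℝ] Lp ℝ 2 μ :=
  (Lp.compMeasurePreservingₗᵢ ℝ (T g) (hT.measurePreserving g)).toContinuousLinearMap

theorem norm_koopman [Semigroup G] (hT : IsMeasurePreservingAction μ T) (g : G) (f : Lp ℝ 2 μ) :
    ‖koopman hT g f‖ = ‖f‖ :=
  Lp.norm_compMeasurePreserving f (hT.measurePreserving g)

theorem koopman_mul [Semigroup G] (hT : IsMeasurePreservingAction μ T) (g k : G) (f : Lp ℝ 2 μ) :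
    koopman hT (g * k) f = koopman hT k (koopman hT g f) := by
  have e := Lp.compMeasurePreserving_comp_apply f (hT.measurePreserving g) (hT.measurePreserving k)
  refine Eq.trans ?_ e
  change Lp.compMeasurePreserving (T (g * k)) _ f = _
  congr 1
  simp only [hT.map_mul]

/-- The map `T 1` is idempotent, hence acts on `L²(μ)` as an idempotent isometry, although it
need not be the identity of `Ω`. -/
theorem koopman_one [Monoid G] (hT : IsMeasurePreservingAction μ T) (f : Lp ℝ 2 μ) :
    koopman hT 1 f = f := by
  have h : koopman hT 1 (koopman hT 1 f - f) = 0 := by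
    rw [map_sub, ← koopman_mul, mul_one, sub_self]
  rwa [← norm_eq_zero, norm_koopman, norm_eq_zero, sub_eq_zero] at h

theorem koopman_indicator [Semigroup G] [IsFiniteMeasure μ] (hT : IsMeasurePreservingAction μ T)
    (g : G) {B : Set Ω} (hB : MeasurableSet B) :
    koopman hT g (indicatorConstLp 2 hB (measure_ne_top μ B) 1) =
      indicatorConstLp 2 ((hT.measurePreserving g).measurable hB) (measure_ne_top μ _) 1 :=
  rfl

end Koopman

section AffineAction

variable {R Ω : Type*} [CommRing R] [IsDomain R] [MeasurableSpace Ω] {μ : Measure Ω}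
  {T : affineSemigroup R → Ω → Ω}

open Classical in
/-- The operator `f ↦ f ∘ T (M_u)` for `u ≠ 0`, and the identity for `u = 0`. -/
noncomputable def koopmanMul (hT : IsMeasurePreservingAction μ T) (u : R) :
    Lp ℝ 2 μ →L[ℝ] Lp ℝ 2 μ :=
  if hu : u ≠ 0 then koopman hT (affMul u hu) else 1

theorem koopmanMul_of_ne (hT : IsMeasurePreservingAction μ T) {u : R} (hu : u ≠ 0) :
    koopmanMul hT u = koopman hT (affMul u hu) :=
  dif_pos hu

theorem affAdd_zero : affAdd (0 : R) = 1 :=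
  Subtype.ext (funext fun x => add_zero x)

theorem affAdd_add (u v : R) : affAdd (u + v) = affAdd v * affAdd u :=
  Subtype.ext (funext fun x => (add_assoc x u v).symm)

theorem affMul_mul {u v : R} (hu : u ≠ 0) (hv : v ≠ 0) :
    affMul (u * v) (mul_ne_zero hu hv) = affMul v hv * affMul u hu :=
  Subtype.ext (funext fun x => show u * v * x = v * (u * x) by ring)

theorem affMul_mul_affAdd {u : R} (hu : u ≠ 0) (v : R) :
    affMul u hu * affAdd v = affAdd (u * v) * affMul u hu :=
  Subtype.ext (funext fun x => mul_add u x v)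

theorem isAffineFamily_koopman (hT : IsMeasurePreservingAction μ T) :
    IsAffineFamily (fun v => koopman hT (affAdd v)) (koopmanMul hT) where
  zero f := by rw [affAdd_zero, koopman_one]
  add u v f := by rw [affAdd_add, koopman_mul]
  mul u v hu hv f := by
    rw [koopmanMul_of_ne hT hu, koopmanMul_of_ne hT hv, koopmanMul_of_ne hT (mul_ne_zero hu hv),
      affMul_mul hu hv, ← koopman_mul]
  comm v u hu f := by
    rw [koopmanMul_of_ne hT hu, ← koopman_mul, affMul_mul_affAdd, koopman_mul]
  norm_add v := norm_koopman hT _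
  norm_mul u hu := by
    rw [koopmanMul_of_ne hT hu]
    exact norm_koopman hT _

theorem returnSet_mem_of_mem_ultraG (hR : IsLID R) [IsProbabilityMeasure μ]
    (hT : IsMeasurePreservingAction μ T) {B : Set Ω} (hB : MeasurableSet B) {ε : ℝ} (hε : 0 < ε)
    {p : Ultrafilter R} (hp : p ∈ ultraG R) : returnSet μ T B ε ∈ p := by
  set f : Lp ℝ 2 μ := indicatorConstLp 2 hB (measure_ne_top μ B) 1
  set e : Lp ℝ 2 μ := indicatorConstLp 2 MeasurableSet.univ (measure_ne_top μ Set.univ) 1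
  have he : ‖e‖ = 1 := by
    rw [norm_indicatorConstLp (by simp) (by simp)]
    simp
  have hfix : ∀ g, koopman hT g e = e := fun g => koopman_indicator hT g MeasurableSet.univ
  obtain ⟨L, hL, hlim⟩ := (isAffineFamily_koopman hT).exists_tendsto_correlation hp.1 hp.2.2.2 hR
    f he (fun v => hfix _) fun u hu => by rw [koopmanMul_of_ne hT hu, hfix]
  have hfe : inner ℝ f e = μ.real B := by
    rw [L2.real_inner_indicatorConstLp_one_indicatorConstLp_one hB MeasurableSet.univ,
      Set.inter_univ]
  rw [hfe] at hL
  filter_upwards [hlim.eventually_const_lt (show μ.real B ^ 2 - ε < L by linarith),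
    Ultrafilter.ne_pure_iff.1 (hp.2.1 0)] with u hu hu0
  refine ⟨hu0, ?_⟩
  rw [koopmanMul_of_ne hT hu0, koopman_indicator, koopman_indicator,
    L2.real_inner_indicatorConstLp_one_indicatorConstLp_one] at hu
  exact hu.le

end AffineAction

theorem mainTheorem2 {R : Type*} [CommRing R] [IsDomain R] (hR : IsLID R)
    {Ω : Type*} [MeasurableSpace Ω] (μ : Measure Ω) [IsProbabilityMeasure μ]
    (T : affineSemigroup R → Ω → Ω) (hT : IsMeasurePreservingAction μ T)
    (B : Set Ω) (hB : MeasurableSet B) (ε : ℝ) (hε : 0 < ε) :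
    IsDCStar (returnSet μ T B ε) ∧
      (∀ p ∈ ultraG R, returnSet μ T B ε ∈ p) ∧
      IsAffinelySyndetic (returnSet μ T B ε) := by
  have h : ∀ p ∈ ultraG R, returnSet μ T B ε ∈ p := fun p hp =>
    returnSet_mem_of_mem_ultraG hR hT hB hε hp
  refine ⟨?_, h, isAffinelySyndetic_of_forall_mem_ultraG hR h⟩
  rintro D ⟨p, hp, hD⟩
  exact p.nonempty_of_mem (Filter.inter_mem (h p hp) hD)
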